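/- Let $r\ge 2$ be an integer and let $A$ be a real $N\times N$ matrix with nonnegative entries that is $r$-potent, i.e. $A^r=A$, and has rank $k$. A standard subspace of $\mathbb R^N$ is a subspace spanned by some of the standard basis vectors. A square matrix is called decomposable if it leaves invariant a standard subspace other than $0$ and the whole space, and indecomposable otherwise. A standard block triangularization of $A$ is a strictly increasing chain $0=M_0\subset M_1\subset\dots\subset M_m=\mathbb R^N$ of $A$-invariant standard subspaces; its $m$ diagonal blocks are the compressions of $A$ to the gaps $M_{j}\ominus M_{j-1}$. It is maximal if the chain is a maximal chain of $A$-invariant standard subspaces. Suppose $A$ is decomposable. Then every maximal standard block triangularization of $A$ has the following properties. (1) Each diagonal block is either zero or an indecomposable $r$-potent matrix of rank at most $r-1$. (2) The number $n$ of nonzero diagonal blocks satisfies $\frac{k}{r-1}\le n\le k$. (3) The total number of diagonal blocks is at least $\frac{k}{r-1}$. Moreover, merge each run of consecutive zero diagonal blocks into one diagonal block (that is, delete from the chain every $M_j$, $0<j<m$, for which the blocks of both adjacent gaps are zero). In the resulting standard block triangularization each diagonal block is again either zero or an indecomposable $r$-potent matrix of rank at most $r-1$, there are again exactly $n$ nonzero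 diagonal blocks, no two consecutive diagonal blocks are zero, and the total number of diagonal blocks lies between $\frac{k}{r-1}$ and $2k+1$. -/

import Mathlib

section RPotentBlocks

variable {ι : Type*} [Fintype ι] [DecidableEq ι]

/-- The standard subspace of `ℝ^ι` spanned by the standard basis vectors `e_i`, `i ∈ s`. -/
def standardSubspace (s : Finset ι) : Submodule ℝ (ι → ℝ) :=
  Submodule.span ℝ {v | ∃ i ∈ s, v = Pi.single i 1}

/-- The standard subspace indexed by `s` is invariant under `A`. -/
def StandardInvariant (A : Matrix ι ι ℝ) (s : Finset ι) : Prop :=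
  ∀ x ∈ standardSubspace s, A.mulVec x ∈ standardSubspace s

/-- `A` is decomposable if it leaves invariant a standard subspace other than `0` and the
whole space. -/
def Decomposable (A : Matrix ι ι ℝ) : Prop :=
  ∃ s : Finset ι, s ≠ ∅ ∧ s ≠ Finset.univ ∧ StandardInvariant A s

def Indecomposable (A : Matrix ι ι ℝ) : Prop := ¬ Decomposable A

def IsRPotent (r : ℕ) (A : Matrix ι ι ℝ) : Prop := A ^ r = A

/-- A standard block triangularization of `A`: a strictly increasing finite chain
`0 = M_0 < M_1 < ... < M_m` (`M_m` the whole space) of `A`-invariant standard subspaces, each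
given by the set of standard basis vectors that span it. Listing the basis vectors gap by gap
gives the permutation which brings `A` to upper block triangular form with `m` diagonal
blocks. -/
structure StdBlockTriang (A : Matrix ι ι ℝ) where
  /-- the number `m` of diagonal blocks -/
  numBlocks : ℕ
  chain : Fin (numBlocks + 1) → Finset ι
  strictMono : StrictMono chain
  chain_zero : chain 0 = ∅
  chain_last : chain (Fin.last numBlocks) = Finset.univ
  invariant : ∀ j, StandardInvariant A (chain j)

namespace StdBlockTriang

variable {A : Matrix ι ι ℝ}

/-- The basis vectors spanning the `j`-th gap `M_{j+1} ⊖ M_j` of the chain. -/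
def gap (T : StdBlockTriang A) (j : Fin T.numBlocks) : Finset ι :=
  T.chain j.succ \ T.chain j.castSucc

/-- The `j`-th diagonal block: the compression of `A` to the `j`-th gap. -/
def diagBlock (T : StdBlockTriang A) (j : Fin T.numBlocks) :
    Matrix (T.gap j) (T.gap j) ℝ :=
  A.submatrix (fun i => (i : ι)) (fun i => (i : ι))

/-- The triangularization is maximal: its chain is a maximal chain of `A`-invariant standard
subspaces, that is, every such subspace comparable with all members is itself a member. -/
def IsMaximal (T : StdBlockTriang A) : Prop :=
  ∀ s : Finset ι, StandardInvariant A s →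
    (∀ j, s ⊆ T.chain j ∨ T.chain j ⊆ s) → ∃ j, T.chain j = s

/-- The number of nonzero diagonal blocks. -/
noncomputable def numNonzero (T : StdBlockTriang A) : ℕ :=
  {j : Fin T.numBlocks | T.diagBlock j ≠ 0}.ncard

open Classical in
/-- The positions in the chain that do not separate two zero diagonal blocks. -/
noncomputable def kept (T : StdBlockTriang A) : Finset (Fin (T.numBlocks + 1)) :=
  Finset.univ.filter fun j =>
    ¬ ∃ a b : Fin T.numBlocks, a.succ = j ∧ b.castSucc = j ∧
      T.diagBlock a = 0 ∧ T.diagBlock b = 0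

theorem zero_mem_kept (T : StdBlockTriang A) : 0 ∈ T.kept := by
  simp only [kept, Finset.mem_filter, Finset.mem_univ, true_and]
  rintro ⟨a, b, ha, -⟩
  exact Fin.succ_ne_zero a ha

theorem last_mem_kept (T : StdBlockTriang A) : Fin.last T.numBlocks ∈ T.kept := by
  simp only [kept, Finset.mem_filter, Finset.mem_univ, true_and]
  rintro ⟨a, b, -, hb, -⟩
  exact (Fin.castSucc_lt_last b).ne hb

theorem card_kept (T : StdBlockTriang A) : T.kept.card = T.kept.card - 1 + 1 :=
  (Nat.sub_add_cancel (Finset.card_pos.2 ⟨0, T.zero_mem_kept⟩)).symm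

/-- The standard block triangularization obtained from `T` by merging each run of consecutive
zero diagonal blocks into a single diagonal block: the members of the chain that separate two
zero diagonal blocks are deleted. -/
noncomputable def mergeZeros (T : StdBlockTriang A) : StdBlockTriang A where
  numBlocks := T.kept.card - 1
  chain j := T.chain (T.kept.orderEmbOfFin T.card_kept j)
  strictMono := T.strictMono.comp (T.kept.orderEmbOfFin T.card_kept).strictMono
  chain_zero := by
    have h : T.kept.orderEmbOfFin T.card_kept 0 = 0 := by
      have hm : (0 : Fin (T.numBlocks + 1)) ∈ Set.range (T.kept.orderEmbOfFin T.card_kept) := by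
        rw [Finset.range_orderEmbOfFin]; exact T.zero_mem_kept
      obtain ⟨x, hx⟩ := hm
      exact le_antisymm (hx ▸ (T.kept.orderEmbOfFin T.card_kept).monotone (Fin.zero_le x))
        (Fin.zero_le _)
    rw [h, T.chain_zero]
  chain_last := by
    have h : T.kept.orderEmbOfFin T.card_kept (Fin.last _) = Fin.last _ := by
      have hm : Fin.last T.numBlocks ∈ Set.range (T.kept.orderEmbOfFin T.card_kept) := by
        rw [Finset.range_orderEmbOfFin]; exact T.last_mem_kept
      obtain ⟨x, hx⟩ := hm
      exact le_antisymm (Fin.le_last _)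
        (hx ▸ (T.kept.orderEmbOfFin T.card_kept).monotone (Fin.le_last x))
    rw [h, T.chain_last]
  invariant _ := T.invariant _

end StdBlockTriang

end RPotentBlocks

/-! ### Invariant standard subspaces, and the rank bound for one indecomposable block. -/

section MatrixLemmas

variable {ι : Type*} [Fintype ι] [DecidableEq ι]

/-! Write r = p + 1. Since A ^ p is idempotent with the rank of A, the rank is the trace of A ^ p
(`rank_eq_trace_pow`). Compression to a gap between invariant sets commutes with powers, so every
block is r-potent and the rank of A is the sum of the ranks of the blocks. Maximality of the chain
makes each block indecomposable, and a Perron–Frobenius argument (`Indecomposable.rank_le`) bounds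
its rank by p. A nonzero block thus contributes between 1 and p to k, which gives k/p ≤ n ≤ k.

A run of zero blocks has zero trace for A ^ p, hence rank zero, so it merges into a genuinely zero
block. The nonzero blocks survive merging, and zero blocks are then isolated, so there are at most
2n + 1 ≤ 2k + 1 blocks. -/

theorem mem_standardSubspace_iff {ι : Type*} [DecidableEq ι] (s : Finset ι) (x : ι → ℝ) :
    x ∈ standardSubspace s ↔ ∀ i ∉ s, x i = 0 := by
  constructor
  · intro hx i hi
    induction hx using Submodule.span_induction with
    | mem v hv =>
      obtain ⟨j, hj, rfl⟩ := hv
      exact Pi.single_eq_of_ne (by rintro rfl; exact hi hj) _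
    | zero => rfl
    | add v w _ _ hv hw => simp [hv, hw]
    | smul c v _ hv => simp [hv]
  · intro hx
    have h : x = ∑ i ∈ s, x i • (Pi.single i 1 : ι → ℝ) := by
      ext j
      by_cases hj : j ∈ s <;> simp [Finset.sum_apply, Pi.single_apply, hj, hx]
    rw [h]
    exact Submodule.sum_mem _ fun i hi =>
      Submodule.smul_mem _ _ (Submodule.subset_span ⟨i, hi, rfl⟩)

theorem standardInvariant_iff (A : Matrix ι ι ℝ) (s : Finset ι) :
    StandardInvariant A s ↔ ∀ j ∈ s, ∀ i ∉ s, A i j = 0 := by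
  constructor
  · intro h j hj i hi
    have := (mem_standardSubspace_iff s _).1
      (h (Pi.single j 1) (Submodule.subset_span ⟨j, hj, rfl⟩)) i hi
    simpa using this
  · intro h x hx
    rw [mem_standardSubspace_iff] at hx ⊢
    intro i hi
    refine Finset.sum_eq_zero fun j _ => ?_
    by_cases hj : j ∈ s
    · simp [h j hj i hi]
    · simp [hx j hj]

theorem StandardInvariant.pow {A : Matrix ι ι ℝ} {s : Finset ι} (h : StandardInvariant A s)
    (n : ℕ) : StandardInvariant (A ^ n) s := by
  induction n with
  | zero => intro x hx; simpa using hx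
  | succ n ih =>
    intro x hx
    rw [pow_succ, ← Matrix.mulVec_mulVec]
    exact ih _ (h x hx)

/-- Each of B and B ^ p is a multiple of the other, so they have equal rank; B ^ p is idempotent,
and an idempotent has rank equal to its trace. -/
theorem rank_eq_trace_pow {p : ℕ} (hp : 1 ≤ p) {B : Matrix ι ι ℝ} (hB : B ^ (p + 1) = B) :
    (B.rank : ℝ) = (B ^ p).trace := by
  have hidem : B ^ p * B ^ p = B ^ p := by
    obtain ⟨q, rfl⟩ : ∃ q, p = q + 1 := ⟨p - 1, by omega⟩
    calc B ^ (q + 1) * B ^ (q + 1) = B ^ (q + 1 + 1) * B ^ q := by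
          rw [← pow_add, ← pow_add]; congr 1; omega
      _ = B ^ (q + 1) := by rw [hB, ← pow_succ']
  have hrank : B.rank = (B ^ p).rank := by
    apply le_antisymm
    · conv_lhs => rw [← hB, pow_succ]
      exact Matrix.rank_mul_le_left _ _
    · obtain ⟨q, rfl⟩ : ∃ q, p = q + 1 := ⟨p - 1, by omega⟩
      rw [pow_succ']
      exact Matrix.rank_mul_le_left _ _
  have h : IsIdempotentElem (Matrix.toLin' (B ^ p)) := by
    rw [IsIdempotentElem, Module.End.mul_eq_comp, ← Matrix.toLin'_mul, hidem]
  rw [hrank, ← Matrix.trace_toLin'_eq, (LinearMap.IsIdempotentElem.isProj_range _ h).trace]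
  rfl

/-- A nonnegative fixed vector of an indecomposable nonnegative matrix that has a vanishing
coordinate is zero. -/
theorem Indecomposable.eq_zero_of_fixed {B : Matrix ι ι ℝ} (hB : Indecomposable B)
    (hnn : ∀ i j, 0 ≤ B i j) {w : ι → ℝ} (hw : ∀ i, 0 ≤ w i) (hfix : B.mulVec w = w)
    {i₀ : ι} (h₀ : w i₀ = 0) : w = 0 := by
  by_contra hne
  -- The support of w is invariant: where w i = 0, the nonnegative terms B i k * w k sum to zero, so
  -- B i j = 0 for every j in the support.
  refine hB ⟨Finset.univ.filter fun j => w j ≠ 0, ?_, ?_, ?_⟩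
  · intro h
    apply hne
    ext j
    by_contra hj
    have : j ∈ (∅ : Finset ι) := h ▸ (by simpa using hj)
    simp at this
  · intro h
    have : i₀ ∈ Finset.univ.filter fun j => w j ≠ 0 := by rw [h]; exact Finset.mem_univ _
    simp [h₀] at this
  · rw [standardInvariant_iff]
    intro j hj i hi
    simp only [Finset.mem_filter, Finset.mem_univ, true_and, not_not] at hj hi
    have h1 : ∑ k, B i k * w k = 0 := by rw [← hi]; exact congrFun hfix i
    have h2 := (Finset.sum_eq_zero_iff_of_nonneg
      fun k _ => mul_nonneg (hnn i k) (hw k)).1 h1 j (Finset.mem_univ _)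
    exact (mul_eq_zero.1 h2).resolve_right hj

/-- A nonzero indecomposable nonnegative matrix with `B ^ (p + 1) = B` has a positive left
fixed vector. -/
theorem Indecomposable.exists_pos_left_fixed {B : Matrix ι ι ℝ} (hB : Indecomposable B)
    (hnn : ∀ i j, 0 ≤ B i j) (hne : B ≠ 0) {p : ℕ} (hp : 1 ≤ p) (hpot : B ^ (p + 1) = B) :
    ∃ u : ι → ℝ, (∀ i, 0 < u i) ∧ Matrix.vecMul u B = u := by
  have hpow : ∀ k i j, 0 ≤ (B ^ k) i j := by
    intro k
    induction k with
    | zero => intro i j; rw [pow_zero, Matrix.one_apply]; positivity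
    | succ k ih =>
      intro i j
      rw [pow_succ, Matrix.mul_apply]
      exact Finset.sum_nonneg fun l _ => mul_nonneg (ih i l) (hnn l j)
  obtain ⟨q, rfl⟩ : ∃ q, p = q + 1 := ⟨p - 1, by omega⟩
  -- S = B + ... + B ^ p absorbs B, since B ^ (p + 1) = B merely cycles the summands. The fixed
  -- vector u consists of the column sums of S.
  set S : Matrix ι ι ℝ := ∑ k ∈ Finset.range (q + 1), B ^ (k + 1) with hS
  have hSB : S * B = S := by
    rw [hS, Finset.sum_mul, Finset.sum_range_succ, Finset.sum_range_succ', ← pow_succ, hpot,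
      zero_add, pow_one]
    simp only [← pow_succ]
  have hBS : ∀ i j, B i j ≤ S i j := by
    intro i j
    rw [hS, Finset.sum_range_succ', Matrix.add_apply, zero_add, pow_one, Matrix.sum_apply]
    exact le_add_of_nonneg_left (Finset.sum_nonneg fun k _ => hpow _ i j)
  have hSnn : ∀ i j, 0 ≤ S i j := fun i j => (hnn i j).trans (hBS i j)
  set u : ι → ℝ := Matrix.vecMul 1 S with hu
  have hu_apply : ∀ j, u j = ∑ i, S i j := by
    intro j; simp [hu, Matrix.vecMul, dotProduct]
  have hu0 : ∀ j, 0 ≤ u j := fun j => by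
    rw [hu_apply]; exact Finset.sum_nonneg fun i _ => hSnn i j
  have hfix : Matrix.vecMul u B = u := by rw [hu, Matrix.vecMul_vecMul, hSB]
  refine ⟨u, fun i₀ => (hu0 i₀).lt_of_ne fun h₀ => ?_, hfix⟩
  -- The zero set of u is invariant. It is not everything, because u = 0 would force S = 0, and B ≤
  -- S entrywise.
  refine hB ⟨Finset.univ.filter fun j => u j = 0, ?_, ?_, ?_⟩
  · exact Finset.ne_empty_of_mem (a := i₀) (by simp [h₀.symm])
  · intro h
    apply hne
    ext i j
    have hj : u j = 0 := by
      have : j ∈ Finset.univ.filter fun j => u j = 0 := by rw [h]; exact Finset.mem_univ _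
      simpa using this
    rw [hu_apply] at hj
    have := (Finset.sum_eq_zero_iff_of_nonneg fun i _ => hSnn i j).1 hj i (Finset.mem_univ _)
    exact le_antisymm ((hBS i j).trans_eq this) (hnn i j)
  · rw [standardInvariant_iff]
    intro j hj i hi
    simp only [Finset.mem_filter, Finset.mem_univ, true_and] at hj hi
    have h1 : ∑ k, u k * B k j = 0 := by rw [← hj]; exact congrFun hfix j
    have h2 := (Finset.sum_eq_zero_iff_of_nonneg
      fun k _ => mul_nonneg (hu0 k) (hnn k j)).1 h1 i (Finset.mem_univ _)
    exact (mul_eq_zero.1 h2).resolve_left hi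

/-- A vector v in the range is determined by the p numbers (B ^ k v) i₀, k < p, at a single
coordinate i₀: the map `L` recording them is injective on the range. -/
theorem Indecomposable.rank_le {B : Matrix ι ι ℝ} (hB : Indecomposable B)
    (hnn : ∀ i j, 0 ≤ B i j) {p : ℕ} (hp : 1 ≤ p) (hpot : B ^ (p + 1) = B) :
    B.rank ≤ p := by
  by_cases hne : B = 0
  · simp [hne]
  obtain ⟨u, hu, hfix⟩ := hB.exists_pos_left_fixed hnn hne hp hpot
  obtain ⟨i₀⟩ : Nonempty ι := by
    by_contra h
    rw [not_nonempty_iff] at h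
    exact hne (Subsingleton.elim _ _)
  let L : (ι → ℝ) →ₗ[ℝ] (Fin p → ℝ) :=
    LinearMap.pi fun k => LinearMap.proj i₀ ∘ₗ (B ^ (k : ℕ)).mulVecLin
  have hL : ∀ v ∈ LinearMap.range B.mulVecLin, L v = 0 → v = 0 := by
    rintro _ ⟨y, rfl⟩ hv
    set v := B.mulVecLin y with hvdef
    have hper : (B ^ p).mulVec v = v := by
      rw [hvdef, Matrix.mulVecLin_apply, Matrix.mulVec_mulVec, ← pow_succ, hpot]
    -- Summing absolute values over the whole orbit of v, which has period dividing p, gives w ≤ B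
    -- w. Pairing with the positive left fixed vector u turns this into equality, so w is a
    -- nonnegative fixed vector, and `L v = 0` says that it vanishes at i₀.
    set w : ι → ℝ := fun i => ∑ k ∈ Finset.range p, |(B ^ k).mulVec v i| with hw
    have hw0 : ∀ i, 0 ≤ w i := fun i => Finset.sum_nonneg fun k _ => abs_nonneg _
    have hle : ∀ i, w i ≤ B.mulVec w i := by
      intro i
      have h1 : w i = ∑ k ∈ Finset.range p, |(B ^ (k + 1)).mulVec v i| := by
        obtain ⟨q, rfl⟩ : ∃ q, p = q + 1 := ⟨p - 1, by omega⟩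
        rw [hw]
        dsimp only
        rw [Finset.sum_range_succ', Finset.sum_range_succ _ q, hper, pow_zero, Matrix.one_mulVec]
      have h2 : B.mulVec w i = ∑ k ∈ Finset.range p, ∑ j, B i j * |(B ^ k).mulVec v j| := by
        rw [Finset.sum_comm]
        simp only [Matrix.mulVec, dotProduct, hw, Finset.mul_sum]
      rw [h1, h2]
      refine Finset.sum_le_sum fun k _ => ?_
      rw [pow_succ', ← Matrix.mulVec_mulVec]
      refine (Finset.abs_sum_le_sum_abs _ _).trans (Finset.sum_le_sum fun j _ => ?_)
      rw [abs_mul, abs_of_nonneg (hnn i j)]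
    have hdot : ∑ i, u i * (B.mulVec w i - w i) = 0 := by
      have : dotProduct u (B.mulVec w) = dotProduct u w := by
        rw [Matrix.dotProduct_mulVec, hfix]
      simp only [mul_sub, Finset.sum_sub_distrib]
      exact sub_eq_zero.2 this
    have hBw : B.mulVec w = w := by
      ext i
      have := (Finset.sum_eq_zero_iff_of_nonneg fun i _ =>
        mul_nonneg (hu i).le (sub_nonneg.2 (hle i))).1 hdot i (Finset.mem_univ _)
      exact sub_eq_zero.1 ((mul_eq_zero.1 this).resolve_left (hu i).ne')
    have hwi : w i₀ = 0 := by
      refine Finset.sum_eq_zero fun k hk => ?_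
      have := congrFun hv ⟨k, Finset.mem_range.1 hk⟩
      simpa [L] using this
    have hwz := hB.eq_zero_of_fixed hnn hw0 hBw hwi
    ext i
    have hi : ∑ k ∈ Finset.range p, |(B ^ k).mulVec v i| = 0 := congrFun hwz i
    have := (Finset.sum_eq_zero_iff_of_nonneg fun k _ => abs_nonneg _).1 hi 0
      (Finset.mem_range.2 (by omega))
    simpa using this
  have hinj : Function.Injective (L.domRestrict (LinearMap.range B.mulVecLin)) := by
    rw [← LinearMap.ker_eq_bot, LinearMap.ker_eq_bot']
    rintro ⟨v, hv⟩ h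
    exact Subtype.ext (hL v hv h)
  simpa [Matrix.rank] using LinearMap.finrank_le_finrank_of_injective hinj

end MatrixLemmas

/-! ### Compressions to gaps between invariant standard subspaces. -/

section Compress

variable {ι : Type*} [Fintype ι] [DecidableEq ι]

/-- The compression of `A` to the standard subspace indexed by `s`. -/
def compress {ι : Type*} (A : Matrix ι ι ℝ) (s : Finset ι) : Matrix s s ℝ :=
  A.submatrix (fun i => (i : ι)) (fun i => (i : ι))

theorem compress_eq_zero_iff {ι : Type*} {A : Matrix ι ι ℝ} {s : Finset ι} :
    compress A s = 0 ↔ ∀ i ∈ s, ∀ j ∈ s, A i j = 0 :=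
  ⟨fun h i hi j hj => congrFun (congrFun h ⟨i, hi⟩) ⟨j, hj⟩,
    fun h => Matrix.ext fun i j => h i i.2 j j.2⟩

theorem compress_eq_zero_of_subset {ι : Type*} {A : Matrix ι ι ℝ} {s t : Finset ι} (hst : s ⊆ t)
    (h : compress A t = 0) : compress A s = 0 :=
  compress_eq_zero_iff.2 fun i hi j hj => compress_eq_zero_iff.1 h i (hst hi) j (hst hj)

theorem compress_mul {A B : Matrix ι ι ℝ} {s t : Finset ι} (hs : StandardInvariant A s)
    (ht : StandardInvariant B t) :
    compress (A * B) (t \ s) = compress A (t \ s) * compress B (t \ s) := by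
  rw [standardInvariant_iff] at hs ht
  ext ⟨i, hi⟩ ⟨j, hj⟩
  rw [Finset.mem_sdiff] at hi hj
  have h1 : (compress A (t \ s) * compress B (t \ s)) ⟨i, Finset.mem_sdiff.2 hi⟩
      ⟨j, Finset.mem_sdiff.2 hj⟩ = ∑ k ∈ t \ s, A i k * B k j := by
    rw [Matrix.mul_apply]
    exact Finset.sum_coe_sort (t \ s) fun k => A i k * B k j
  rw [h1]
  -- Indices k outside the gap contribute nothing: if k ∈ s then A i k = 0 as i ∉ s, and if k ∉ t
  -- then B k j = 0 as j ∈ t.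
  refine (Finset.sum_subset (Finset.subset_univ _) fun k _ hk => ?_).symm
  rw [Finset.mem_sdiff, not_and_not_right] at hk
  change A i k * B k j = 0
  by_cases hkt : k ∈ t
  · rw [hs k (hk hkt) i hi.2, zero_mul]
  · rw [ht j hj.1 k hkt, mul_zero]

theorem compress_pow {A : Matrix ι ι ℝ} {s t : Finset ι} (hs : StandardInvariant A s)
    (ht : StandardInvariant A t) (n : ℕ) :
    compress (A ^ n) (t \ s) = compress A (t \ s) ^ n := by
  induction n with
  | zero =>
    rw [pow_zero, pow_zero]
    exact Matrix.submatrix_one _ Subtype.val_injective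
  | succ n ih => rw [pow_succ, compress_mul (hs.pow n) ht, ih, pow_succ]

theorem isRPotent_compress {r : ℕ} {A : Matrix ι ι ℝ} (hA : IsRPotent r A) {s t : Finset ι}
    (hs : StandardInvariant A s) (ht : StandardInvariant A t) :
    IsRPotent r (compress A (t \ s)) := by
  rw [IsRPotent, ← compress_pow hs ht, hA]

theorem rank_compress {p : ℕ} (hp : 1 ≤ p) {A : Matrix ι ι ℝ} (hA : IsRPotent (p + 1) A)
    {s t : Finset ι} (hs : StandardInvariant A s) (ht : StandardInvariant A t) :
    ((compress A (t \ s)).rank : ℝ) = ∑ i ∈ t \ s, (A ^ p) i i := by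
  rw [rank_eq_trace_pow hp (isRPotent_compress hA hs ht), ← compress_pow hs ht]
  exact Finset.sum_coe_sort (t \ s) fun i => (A ^ p) i i

theorem eq_zero_of_rank_eq_zero {A : Matrix ι ι ℝ} (h : A.rank = 0) : A = 0 := by
  rw [Matrix.rank, Submodule.finrank_eq_zero, LinearMap.range_eq_bot] at h
  ext i j
  simpa using congrFun (LinearMap.congr_fun h (Pi.single j 1)) i

/-- If the compression of `A` to a gap between invariant sets is decomposable, then there is an
invariant set strictly in between. -/
theorem exists_between_of_decomposable {A : Matrix ι ι ℝ} {s t : Finset ι} (hst : s ⊆ t)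
    (hs : StandardInvariant A s) (ht : StandardInvariant A t)
    (hdec : Decomposable (compress A (t \ s))) :
    ∃ u, s ⊂ u ∧ u ⊂ t ∧ StandardInvariant A u := by
  obtain ⟨v, hv0, hv1, hv⟩ := hdec
  rw [standardInvariant_iff] at hs ht hv
  have hvmem : ∀ {x}, x ∈ v.map (Function.Embedding.subtype _) → x ∈ t \ s := by
    intro x hx
    obtain ⟨y, -, rfl⟩ := Finset.mem_map.1 hx
    exact y.2
  refine ⟨s ∪ v.map (Function.Embedding.subtype _), ?_, ?_, ?_⟩
  · obtain ⟨x, hx⟩ := Finset.nonempty_iff_ne_empty.2 hv0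
    refine Finset.ssubset_iff_subset_ne.2 ⟨Finset.subset_union_left, fun h => ?_⟩
    refine (Finset.mem_sdiff.1 x.2).2 ?_
    refine h.ge ?_
    exact Finset.mem_union_right _ (Finset.mem_map_of_mem (Function.Embedding.subtype _) hx)
  · refine Finset.ssubset_iff_subset_ne.2 ⟨Finset.union_subset hst fun x hx =>
      (Finset.mem_sdiff.1 (hvmem hx)).1, fun h => hv1 (Finset.eq_univ_iff_forall.2 fun x => ?_)⟩
    have hx := Finset.mem_sdiff.1 x.2
    simpa using (Finset.mem_union.1 (h.ge hx.1)).resolve_left hx.2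
  · rw [standardInvariant_iff]
    intro j hj i hi
    rw [Finset.mem_union, not_or] at hi
    rcases Finset.mem_union.1 hj with hj | hj
    · exact hs j hj i hi.1
    · obtain ⟨y, hy, rfl⟩ := Finset.mem_map.1 hj
      by_cases hit : i ∈ t
      · refine hv y hy ⟨i, Finset.mem_sdiff.2 ⟨hit, hi.1⟩⟩ fun hmem => hi.2 ?_
        exact Finset.mem_map_of_mem (Function.Embedding.subtype _) hmem
      · exact ht _ (Finset.mem_sdiff.1 y.2).1 i hit

end Compress

/-- If no two consecutive positions satisfy `Z`, then at least about half of the positions do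
not. -/
theorem le_two_mul_ncard_add_one {m : ℕ} {Z : Fin m → Prop}
    (h : ∀ i j : Fin m, (i : ℕ) + 1 = j → ¬ (Z i ∧ Z j)) :
    m ≤ 2 * {j | ¬ Z j}.ncard + 1 := by
  classical
  have hcard : {j | ¬ Z j}.ncard = (Finset.univ.filter fun j => ¬ Z j).card := by
    rw [← Set.ncard_coe_finset]; simp
  have hle : (Finset.univ.filter Z).card ≤ (Finset.univ.filter fun j => ¬ Z j).card + 1 := by
    -- The successor of a position in `Z` is either a position outside `Z` or the out-of-range value
    -- m, which accounts for the extra 1.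
    have hsub : (Finset.univ.filter Z).image (fun j : Fin m => (j : ℕ) + 1) ⊆
        insert m ((Finset.univ.filter fun j => ¬ Z j).image fun j : Fin m => (j : ℕ)) := by
      intro x hx
      obtain ⟨j, hj, rfl⟩ := Finset.mem_image.1 hx
      rw [Finset.mem_insert, Finset.mem_image]
      rcases (Nat.succ_le_of_lt j.2).eq_or_lt with hm | hm
      · exact Or.inl hm
      · exact Or.inr ⟨⟨j + 1, hm⟩, by
          simpa using fun hz => h j ⟨j + 1, hm⟩ rfl ⟨(Finset.mem_filter.1 hj).2, hz⟩, rfl⟩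
    have h1 := Finset.card_le_card hsub
    rw [Finset.card_image_of_injective _ fun a b hab => Fin.ext (Nat.succ_injective hab)] at h1
    exact h1.trans ((Finset.card_insert_le _ _).trans
      (Nat.add_le_add_right Finset.card_image_le _))
  have hsum := Finset.card_filter_add_card_filter_not (s := (Finset.univ : Finset (Fin m))) Z
  rw [Finset.card_univ, Fintype.card_fin] at hsum
  omega

/-! ### Diagonal blocks of a chain and additivity of the rank. -/

namespace StdBlockTriang

variable {ι : Type*} [Fintype ι] [DecidableEq ι] {A : Matrix ι ι ℝ}

theorem isRPotent_diagBlock (T : StdBlockTriang A) {r : ℕ} (hA : IsRPotent r A)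
    (j : Fin T.numBlocks) : IsRPotent r (T.diagBlock j) :=
  isRPotent_compress hA (T.invariant _) (T.invariant _)

theorem IsMaximal.indecomposable_diagBlock {T : StdBlockTriang A} (hT : T.IsMaximal)
    (j : Fin T.numBlocks) : Indecomposable (T.diagBlock j) := by
  intro hdec
  obtain ⟨u, hu1, hu2, hu⟩ := exists_between_of_decomposable
    (T.strictMono j.castSucc_lt_succ).le (T.invariant _) (T.invariant _) hdec
  -- An invariant set strictly between two consecutive members is comparable with the whole chain,
  -- so maximality would make it a member, with an index strictly between consecutive integers.
  obtain ⟨i, rfl⟩ := hT u hu fun i => by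
    rcases le_or_gt i j.castSucc with hi | hi
    · exact Or.inr ((T.strictMono.monotone hi).trans hu1.le)
    · exact Or.inl (hu2.le.trans (T.strictMono.monotone (Fin.castSucc_lt_iff_succ_le.1 hi)))
  have h1 := T.strictMono.lt_iff_lt.1 hu1
  have h2 := T.strictMono.lt_iff_lt.1 hu2
  rw [Fin.lt_def, Fin.val_castSucc] at h1
  rw [Fin.lt_def, Fin.val_succ] at h2
  omega

/-- Each block's rank is the partial trace of A ^ p over its gap, and these partial traces telescope
along the chain. -/
theorem rank_eq_sum_rank_diagBlock (T : StdBlockTriang A) {p : ℕ} (hp : 1 ≤ p)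
    (hA : IsRPotent (p + 1) A) : A.rank = ∑ j, (T.diagBlock j).rank := by
  have hblock : ∀ j, ((T.diagBlock j).rank : ℝ) =
      ∑ i ∈ T.chain j.succ, (A ^ p) i i - ∑ i ∈ T.chain j.castSucc, (A ^ p) i i := fun j =>
    (rank_compress hp hA (T.invariant _) (T.invariant _)).trans
      (Finset.sum_sdiff_eq_sub (T.strictMono j.castSucc_lt_succ).le)
  have htel := (Fin.sum_univ_succ fun j => ∑ i ∈ T.chain j, (A ^ p) i i).symm.trans
    (Fin.sum_univ_castSucc fun j => ∑ i ∈ T.chain j, (A ^ p) i i)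
  rw [T.chain_zero, T.chain_last, Finset.sum_empty, zero_add] at htel
  have : (A.rank : ℝ) = ∑ j, ((T.diagBlock j).rank : ℝ) := by
    rw [rank_eq_trace_pow hp hA]
    simp only [hblock, Finset.sum_sub_distrib]
    rw [htel, add_sub_cancel_left]
    rfl
  exact_mod_cast this

theorem numNonzero_le_numBlocks (T : StdBlockTriang A) : T.numNonzero ≤ T.numBlocks := by
  simpa [numNonzero] using Set.ncard_le_card {j : Fin T.numBlocks | T.diagBlock j ≠ 0}

theorem numNonzero_le_rank (T : StdBlockTriang A) {p : ℕ} (hp : 1 ≤ p)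
    (hA : IsRPotent (p + 1) A) : T.numNonzero ≤ A.rank := by
  classical
  rw [T.rank_eq_sum_rank_diagBlock hp hA, numNonzero, Set.ncard_eq_toFinset_card',
    Set.toFinset_ofPred, Finset.card_filter]
  refine Finset.sum_le_sum fun j _ => ?_
  split_ifs with h
  · exact Nat.one_le_iff_ne_zero.2 fun h0 => h (eq_zero_of_rank_eq_zero h0)
  · exact Nat.zero_le _

theorem rank_le_numNonzero_mul (T : StdBlockTriang A) {p : ℕ} (hp : 1 ≤ p)
    (hA : IsRPotent (p + 1) A) (hrank : ∀ j, (T.diagBlock j).rank ≤ p) :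
    A.rank ≤ T.numNonzero * p := by
  classical
  rw [T.rank_eq_sum_rank_diagBlock hp hA, numNonzero, Set.ncard_eq_toFinset_card',
    Set.toFinset_ofPred, Finset.card_filter, Finset.sum_mul]
  refine Finset.sum_le_sum fun j _ => ?_
  split_ifs with h
  · simpa using hrank j
  · simp [not_not.1 h]

theorem exists_mem_gap (T : StdBlockTriang A) {a b : Fin (T.numBlocks + 1)} {i : ι}
    (ha : i ∉ T.chain a) (hb : i ∈ T.chain b) :
    ∃ c : Fin T.numBlocks, a ≤ c.castSucc ∧ c.succ ≤ b ∧ i ∈ T.gap c := by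
  induction b using Fin.induction with
  | zero => rw [T.chain_zero] at hb; simp at hb
  | succ c ih =>
    by_cases hc : i ∈ T.chain c.castSucc
    · obtain ⟨d, h1, h2, h3⟩ := ih hc
      exact ⟨d, h1, h2.trans c.castSucc_lt_succ.le, h3⟩
    · refine ⟨c, le_of_not_gt fun h => ha ?_, le_rfl, Finset.mem_sdiff.2 ⟨hb, hc⟩⟩
      exact T.strictMono.monotone (Fin.castSucc_lt_iff_succ_le.1 h) hb

/-- If all diagonal blocks between two members of the chain vanish, then so does the compression
of `A` to the gap between these members. -/
theorem compress_eq_zero_of_diagBlock_eq_zero (T : StdBlockTriang A) {p : ℕ} (hp : 1 ≤ p)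
    (hA : IsRPotent (p + 1) A) {a b : Fin (T.numBlocks + 1)}
    (h : ∀ c : Fin T.numBlocks, a ≤ c.castSucc → c.succ ≤ b → T.diagBlock c = 0) :
    compress A (T.chain b \ T.chain a) = 0 := by
  apply eq_zero_of_rank_eq_zero
  have hrank := rank_compress hp hA (T.invariant a) (T.invariant b)
  -- The rank is a sum of diagonal entries of A ^ p; each lies in the gap of some zero block, where
  -- A ^ p compresses to 0 ^ p = 0 because p ≥ 1.
  rw [Finset.sum_eq_zero fun i hi => ?_] at hrank
  · exact_mod_cast hrank
  rw [Finset.mem_sdiff] at hi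
  obtain ⟨c, h1, h2, h3⟩ := T.exists_mem_gap hi.2 hi.1
  have hz : compress (A ^ p) (T.gap c) = 0 := by
    have hc : compress A (T.gap c) = 0 := h c h1 h2
    rw [gap, compress_pow (T.invariant _) (T.invariant _), ← gap, hc, zero_pow (by omega)]
  exact compress_eq_zero_iff.1 hz i h3 i h3

/-! ### Merging runs of zero blocks. -/

theorem notMem_kept_iff {T : StdBlockTriang A} {x : Fin (T.numBlocks + 1)} :
    x ∉ T.kept ↔ ∃ a b : Fin T.numBlocks, a.succ = x ∧ b.castSucc = x ∧
      T.diagBlock a = 0 ∧ T.diagBlock b = 0 := by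
  classical
  simp [kept]

/-- The positions in the chain of `T` of the members of the merged chain. -/
noncomputable def keptPos (T : StdBlockTriang A) :
    Fin (T.mergeZeros.numBlocks + 1) ↪o Fin (T.numBlocks + 1) :=
  T.kept.orderEmbOfFin T.card_kept

theorem mergeZeros_gap (T : StdBlockTriang A) (j : Fin T.mergeZeros.numBlocks) :
    T.mergeZeros.gap j = T.chain (T.keptPos j.succ) \ T.chain (T.keptPos j.castSucc) := rfl

theorem keptPos_mem (T : StdBlockTriang A) (y) : T.keptPos y ∈ T.kept :=
  Finset.orderEmbOfFin_mem _ _ _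

theorem exists_keptPos_eq {T : StdBlockTriang A} {x : Fin (T.numBlocks + 1)} (hx : x ∈ T.kept) :
    ∃ y, T.keptPos y = x := by
  have : x ∈ Set.range (T.kept.orderEmbOfFin T.card_kept) := by
    rw [Finset.range_orderEmbOfFin]; exact hx
  exact this

theorem notMem_kept_of_between (T : StdBlockTriang A) (j : Fin T.mergeZeros.numBlocks)
    {x : Fin (T.numBlocks + 1)} (h1 : T.keptPos j.castSucc < x) (h2 : x < T.keptPos j.succ) :
    x ∉ T.kept := by
  intro hx
  obtain ⟨y, rfl⟩ := exists_keptPos_eq hx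
  rw [OrderEmbedding.lt_iff_lt, Fin.lt_def] at h1 h2
  rw [Fin.val_castSucc] at h1
  rw [Fin.val_succ] at h2
  omega

/-- The first of the blocks of `T` that make up the `j`-th block of the merged
triangularization. -/
noncomputable def firstBlock (T : StdBlockTriang A) (j : Fin T.mergeZeros.numBlocks) :
    Fin T.numBlocks :=
  (T.keptPos j.castSucc).castLT
    ((T.keptPos.strictMono j.castSucc_lt_succ).trans_le (Fin.le_last _))

theorem castSucc_firstBlock (T : StdBlockTriang A) (j : Fin T.mergeZeros.numBlocks) :
    (T.firstBlock j).castSucc = T.keptPos j.castSucc := rfl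

theorem firstBlock_injective (T : StdBlockTriang A) : Function.Injective T.firstBlock := by
  intro i j h
  have := congrArg Fin.castSucc h
  rw [castSucc_firstBlock, castSucc_firstBlock] at this
  exact Fin.castSucc_injective _ (T.keptPos.injective this)

/-- A block of the merged triangularization is a block of `T` or is zero. -/
theorem mergeZeros_gap_eq_or (T : StdBlockTriang A) {p : ℕ} (hp : 1 ≤ p)
    (hA : IsRPotent (p + 1) A) (j : Fin T.mergeZeros.numBlocks) :
    T.mergeZeros.gap j = T.gap (T.firstBlock j) ∨ compress A (T.mergeZeros.gap j) = 0 := by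
  rcases eq_or_ne (T.firstBlock j).succ (T.keptPos j.succ) with h | h
  · left
    rw [mergeZeros_gap, gap, castSucc_firstBlock, h]
  · right
    have hlt : (T.firstBlock j).succ < T.keptPos j.succ := by
      refine lt_of_le_of_ne (Fin.castSucc_lt_iff_succ_le.1 ?_) h
      rw [castSucc_firstBlock]
      exact T.keptPos.strictMono j.castSucc_lt_succ
    rw [mergeZeros_gap]
    -- Every original block inside a merged gap of several blocks touches a deleted position: its
    -- right end if it comes first, its left end otherwise. Deleted positions have zero blocks on
    -- both sides.
    refine T.compress_eq_zero_of_diagBlock_eq_zero hp hA fun c h1 h2 => ?_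
    rcases h1.eq_or_lt with h3 | h3
    · rw [← castSucc_firstBlock] at h3
      obtain rfl := Fin.castSucc_injective _ h3
      obtain ⟨a, b, ha, hb, hza, hzb⟩ := notMem_kept_iff.1 (T.notMem_kept_of_between j
        (by rw [← castSucc_firstBlock]; exact Fin.castSucc_lt_succ) hlt)
      rwa [← Fin.succ_injective _ ha]
    · obtain ⟨a, b, ha, hb, hza, hzb⟩ := notMem_kept_iff.1 (T.notMem_kept_of_between j h3
        (c.castSucc_lt_succ.trans_le h2))
      rwa [← Fin.castSucc_injective _ hb]

theorem gap_subset_mergeZeros_gap (T : StdBlockTriang A) (j : Fin T.mergeZeros.numBlocks)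
    {c : Fin T.numBlocks} (h1 : T.keptPos j.castSucc ≤ c.castSucc)
    (h2 : c.succ ≤ T.keptPos j.succ) : T.gap c ⊆ T.mergeZeros.gap j :=
  Finset.sdiff_subset_sdiff (T.strictMono.monotone h2) (T.strictMono.monotone h1)

/-- `firstBlock` is a bijection between nonzero blocks. For surjectivity, both ends of a nonzero
block of `T` are kept, so it lies in the merged block starting at its left end; that merged block
cannot vanish, since its compressions would vanish too. -/
theorem mergeZeros_numNonzero (T : StdBlockTriang A) {p : ℕ} (hp : 1 ≤ p)
    (hA : IsRPotent (p + 1) A) : T.mergeZeros.numNonzero = T.numNonzero := by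
  have key : ∀ j, T.mergeZeros.gap j = T.gap (T.firstBlock j) →
      T.mergeZeros.diagBlock j ≠ 0 → T.diagBlock (T.firstBlock j) ≠ 0 := by
    intro j h h0
    change compress A (T.mergeZeros.gap j) ≠ 0 at h0
    rw [h] at h0
    exact h0
  refine Set.ncard_congr (fun j _ => T.firstBlock j) (fun j hj => ?_)
    (fun i j _ _ h => T.firstBlock_injective h) fun c hc => ?_
  · exact key j ((T.mergeZeros_gap_eq_or hp hA j).resolve_right hj) hj
  · obtain ⟨x, hx⟩ : ∃ x, T.keptPos x = c.castSucc := exists_keptPos_eq <| by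
      by_contra h
      obtain ⟨a, b, -, hb, -, hz⟩ := notMem_kept_iff.1 h
      exact hc (Fin.castSucc_injective _ hb ▸ hz)
    obtain ⟨y, hy⟩ : ∃ y, T.keptPos y = c.succ := exists_keptPos_eq <| by
      by_contra h
      obtain ⟨a, b, ha, -, hz, -⟩ := notMem_kept_iff.1 h
      exact hc (Fin.succ_injective _ ha ▸ hz)
    have hxy : x < y := by
      rw [← T.keptPos.lt_iff_lt, hx, hy]; exact c.castSucc_lt_succ
    obtain ⟨j, rfl⟩ := Fin.exists_castSucc_eq.2 (hxy.trans_le (Fin.le_last y)).ne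
    refine ⟨j, fun h0 => hc ?_, Fin.castSucc_injective _ ((T.castSucc_firstBlock j).trans hx)⟩
    refine compress_eq_zero_of_subset (T.gap_subset_mergeZeros_gap j hx.le ?_) h0
    rw [← Fin.castSucc_lt_iff_succ_le, ← hx]
    exact T.keptPos.strictMono j.castSucc_lt_succ

theorem mergeZeros_not_consecutive_zero (T : StdBlockTriang A)
    (i j : Fin T.mergeZeros.numBlocks) (hij : (i : ℕ) + 1 = j) :
    ¬ (T.mergeZeros.diagBlock i = 0 ∧ T.mergeZeros.diagBlock j = 0) := by
  rintro ⟨hi, hj⟩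
  have hji : j.castSucc = i.succ := Fin.ext hij.symm
  have hlt := T.keptPos.strictMono i.castSucc_lt_succ
  obtain ⟨a, ha⟩ := Fin.exists_succ_eq.2 ((Fin.zero_le _).trans_lt hlt).ne'
  -- If two adjacent merged blocks vanish, so do the original blocks on either side of their common
  -- boundary, and that boundary would have been deleted.
  refine notMem_kept_iff.2 ⟨a, T.firstBlock j, ha, ?_, ?_, ?_⟩ (T.keptPos_mem i.succ)
  · rw [castSucc_firstBlock, hji]
  · refine compress_eq_zero_of_subset (T.gap_subset_mergeZeros_gap i ?_ ha.le) hi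
    rw [← ha] at hlt
    exact Fin.le_castSucc_iff.2 hlt
  · refine compress_eq_zero_of_subset (T.gap_subset_mergeZeros_gap j le_rfl ?_) hj
    rw [← Fin.castSucc_lt_iff_succ_le, castSucc_firstBlock]
    exact T.keptPos.strictMono j.castSucc_lt_succ

end StdBlockTriang

theorem mainTheorem3 {N : ℕ} (r : ℕ) (hr : 2 ≤ r) (A : Matrix (Fin N) (Fin N) ℝ)
    (hnonneg : ∀ i j, 0 ≤ A i j) (hpot : IsRPotent r A) (hdec : Decomposable A)
    (T : StdBlockTriang A) (hT : T.IsMaximal) :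
    -- each diagonal block is zero or an indecomposable r-potent of rank at most r - 1
    (∀ j, T.diagBlock j = 0 ∨
      (Indecomposable (T.diagBlock j) ∧ IsRPotent r (T.diagBlock j) ∧
        (T.diagBlock j).rank ≤ r - 1)) ∧
    -- the number of nonzero diagonal blocks
    ((A.rank : ℝ) / ((r : ℝ) - 1) ≤ (T.numNonzero : ℝ) ∧ T.numNonzero ≤ A.rank) ∧
    -- the total number of diagonal blocks, from below
    (A.rank : ℝ) / ((r : ℝ) - 1) ≤ (T.numBlocks : ℝ) ∧
    -- after merging runs of consecutive zero blocks: the same properties, no two consecutive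
    -- zero blocks, and the two-sided bound on the total number of diagonal blocks
    (∀ j, T.mergeZeros.diagBlock j = 0 ∨
      (Indecomposable (T.mergeZeros.diagBlock j) ∧ IsRPotent r (T.mergeZeros.diagBlock j) ∧
        (T.mergeZeros.diagBlock j).rank ≤ r - 1)) ∧
    T.mergeZeros.numNonzero = T.numNonzero ∧
    (∀ i j : Fin T.mergeZeros.numBlocks, (i : ℕ) + 1 = (j : ℕ) →
      ¬ (T.mergeZeros.diagBlock i = 0 ∧ T.mergeZeros.diagBlock j = 0)) ∧
    ((A.rank : ℝ) / ((r : ℝ) - 1) ≤ (T.mergeZeros.numBlocks : ℝ) ∧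
      T.mergeZeros.numBlocks ≤ 2 * A.rank + 1) := by
  obtain ⟨p, rfl⟩ : ∃ p, r = p + 1 := ⟨r - 1, by omega⟩
  have hp : 1 ≤ p := by omega
  have hcast : ((p + 1 : ℕ) : ℝ) - 1 = p := by push_cast; ring
  rw [hcast, Nat.add_sub_cancel]
  have hgood : ∀ j, Indecomposable (T.diagBlock j) ∧ IsRPotent (p + 1) (T.diagBlock j) ∧
      (T.diagBlock j).rank ≤ p := fun j =>
    ⟨hT.indecomposable_diagBlock j, T.isRPotent_diagBlock hpot j,
      (hT.indecomposable_diagBlock j).rank_le (fun _ _ => hnonneg _ _) hp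
        (T.isRPotent_diagBlock hpot j)⟩
  have hlow : (A.rank : ℝ) / p ≤ T.numNonzero := by
    rw [div_le_iff₀ (by exact_mod_cast hp)]
    exact_mod_cast T.rank_le_numNonzero_mul hp hpot fun j => (hgood j).2.2
  have hmerge := T.mergeZeros_numNonzero hp hpot
  have hcons := T.mergeZeros_not_consecutive_zero
  refine ⟨fun j => Or.inr (hgood j), ⟨hlow, T.numNonzero_le_rank hp hpot⟩,
    hlow.trans (by exact_mod_cast T.numNonzero_le_numBlocks), fun j => ?_, hmerge, hcons,
    hlow.trans ?_, ?_⟩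
  · rcases T.mergeZeros_gap_eq_or hp hpot j with h | h
    · right
      change Indecomposable (compress A (T.mergeZeros.gap j)) ∧
        IsRPotent (p + 1) (compress A (T.mergeZeros.gap j)) ∧
        (compress A (T.mergeZeros.gap j)).rank ≤ p
      rw [h]
      exact hgood _
    · exact Or.inl h
  · rw [← hmerge]
    exact_mod_cast T.mergeZeros.numNonzero_le_numBlocks
  · have h := le_two_mul_ncard_add_one hcons
    change _ ≤ 2 * T.mergeZeros.numNonzero + 1 at h
    have := T.numNonzero_le_rank hp hpot
    omega
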